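/- Let $V$ be a separable right quaternionic Hilbert space, let $\mathcal B(V)$ be the real algebra of bounded right $\mathbb H$-linear operators on $V$, let $\mathcal K(V)$ be the closed two-sided ideal of compact operators, and let $\pi:\mathcal B(V)\to\mathcal B(V)/\mathcal K(V)$ be the quotient map onto the Calkin algebra. For $T\in\mathcal B(V)$ and $q\in\mathbb H$ put $R_q(T)=T^2-2\,\mathrm{Re}(q)\,T+|q|^2 I$. Call $A\in\mathcal B(V)$ a Fredholm element ($A\in\Phi_\pi$) if $\pi(A)$ is invertible in $\mathcal B(V)/\mathcal K(V)$, and a Weyl element ($A\in\Phi^0_\pi$) if $A=U+K$ with $U\in\mathcal B(V)$ invertible in $\mathcal B(V)$ and $K\in\mathcal K(V)$. Define $$\Phi_{T,\pi}=\{q\in\mathbb H: R_q(T)\in\Phi_\pi\},$$ the Calkin (Fredholm) S-spectrum $$\sigma^{\Phi}_{S,\pi}(T)=\sigma_S(\pi(T))=\{q\in\mathbb H: \pi(T)^2-2\,\mathrm{Re}(q)\,\pi(T)+|q|^2\,1 \text{ is not invertible in } \mathcal B(V)/\mathcal K(V)\},$$ and the Weyl S-spectrum $$\sigma^{\Phi^0}_{S,\pi}(T)=\{q\in\mathbb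 H: R_q(T)\notin\Phi^0_\pi\}.$$ If $T\in\mathcal B(V)$ and $\Phi_{T,\pi}$ is connected, then $$\sigma^{\Phi}_{S,\pi}(T)=\sigma^{\Phi^0}_{S,\pi}(T).$$ -/

import Mathlib

open scoped Quaternion

noncomputable section

/-- A right quaternionic inner product space: a right vector space over `ℍ` (a module over `ℍᵐᵒᵖ`,
`MulOpposite.op q • x` being `x q`) with a quaternion-valued inner product, additive and right
`ℍ`-homogeneous in the second variable, Hermitian, and inducing the norm of `V`. -/
class RightQuaternionicInnerProductSpace (V : Type*) [NormedAddCommGroup V]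
    [Module ℍ[ℝ]ᵐᵒᵖ V] where
  /-- the quaternion-valued inner product -/
  qinner : V → V → ℍ[ℝ]
  star_qinner : ∀ x y, star (qinner x y) = qinner y x
  qinner_self : ∀ x, qinner x x = ((‖x‖ ^ 2 : ℝ) : ℍ[ℝ])
  qinner_add_right : ∀ x y z, qinner x (y + z) = qinner x y + qinner x z
  qinner_smul_right : ∀ (x y : V) (q : ℍ[ℝ]), qinner x (MulOpposite.op q • y) = qinner x y * q

namespace RightQuaternionic

section RealAlgebra

variable {A B : Type*} [Ring A] [Algebra ℝ A] [Ring B] [Algebra ℝ B]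

/-- `R_q(v) = v² - 2 Re(q) v + |q|² 1`. -/
def sPoly (q : ℍ[ℝ]) (v : A) : A :=
  v ^ 2 - (2 * q.re) • v + (‖q‖ ^ 2) • (1 : A)

/-- The S-spectrum of `v`: the quaternions `q` for which `R_q(v)` is not invertible. -/
def sSpectrum (v : A) : Set ℍ[ℝ] := {q | ¬ IsUnit (sPoly q v)}

/-- Fredholm elements relative to a homomorphism: those with invertible image. -/
def fredholmElements (f : A →ₐ[ℝ] B) : Set A := {v | IsUnit (f v)}

/-- Weyl elements relative to a homomorphism: the sums of an invertible element and an element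
of the kernel. -/
def weylElements (f : A →ₐ[ℝ] B) : Set A := {v | ∃ u k, IsUnit u ∧ f k = 0 ∧ v = u + k}

/-- The Fredholm S-spectrum of `v` relative to `f`. -/
def fredholmSSpectrum (f : A →ₐ[ℝ] B) (v : A) : Set ℍ[ℝ] := sSpectrum (f v)

/-- The Weyl S-spectrum of `v` relative to `f`. -/
def weylSSpectrum (f : A →ₐ[ℝ] B) (v : A) : Set ℍ[ℝ] := {q | sPoly q v ∉ weylElements f}

/-- The set of quaternions `q` such that `R_q(v)` is a Fredholm element relative to `f`. -/
def fredholmSDomain (f : A →ₐ[ℝ] B) (v : A) : Set ℍ[ℝ] := {q | sPoly q v ∈ fredholmElements f}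

end RealAlgebra

section Operators

variable {V : Type*} [NormedAddCommGroup V] [Module ℍ[ℝ]ᵐᵒᵖ V]

open RightQuaternionicInnerProductSpace in
theorem norm_op_smul [RightQuaternionicInnerProductSpace V] (q : ℍ[ℝ]) (x : V) :
    ‖MulOpposite.op q • x‖ = ‖q‖ * ‖x‖ := by
  have h1 : qinner (MulOpposite.op q • x) x = star q * qinner x x := by
    rw [← star_qinner, qinner_smul_right, star_mul, star_qinner]
  have h2 : ((‖MulOpposite.op q • x‖ ^ 2 : ℝ) : ℍ[ℝ]) = (((‖q‖ * ‖x‖) ^ 2 : ℝ) : ℍ[ℝ]) := by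
    rw [← qinner_self, qinner_smul_right, h1, qinner_self, mul_assoc,
      Quaternion.coe_commutes, ← mul_assoc, Quaternion.star_mul_self,
      Quaternion.normSq_eq_norm_mul_self, ← Quaternion.coe_mul]
    congr 1
    ring
  have h3 := Quaternion.coe_injective h2
  exact (pow_left_inj₀ (norm_nonneg _) (by positivity) two_ne_zero).1 h3

variable (V) in
/-- The bounded right linear operators `x ↦ x r`, for real `r`. -/
def realScalar [RightQuaternionicInnerProductSpace V] : ℝ →+* (V →L[ℍ[ℝ]ᵐᵒᵖ] V) where
  toFun r :=
    { toFun := fun x => MulOpposite.op (r : ℍ[ℝ]) • x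
      map_add' := fun x y => smul_add _ x y
      map_smul' := fun q x => by
        simp only [RingHom.id_apply, smul_smul]
        congr 1
        apply MulOpposite.unop_injective
        simp [Quaternion.coe_commutes]
      cont := by
        refine (LipschitzWith.of_dist_le_mul (K := ‖(r : ℍ[ℝ])‖₊) fun x y => ?_).continuous
        rw [dist_eq_norm, dist_eq_norm, ← smul_sub, norm_op_smul, coe_nnnorm] }
  map_one' := by ext x; simp
  map_zero' := by ext x; simp
  map_mul' r s := by
    ext x
    change MulOpposite.op ((r * s : ℝ) : ℍ[ℝ]) • x =
      MulOpposite.op (r : ℍ[ℝ]) • MulOpposite.op (s : ℍ[ℝ]) • x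
    rw [smul_smul, ← MulOpposite.op_mul, mul_comm r s, Quaternion.coe_mul]
  map_add' r s := by ext x; simp [add_smul]

/-- The real algebra of bounded right linear operators: `(r • T) x = (T x) r` for real `r`. -/
instance operatorAlgebra [RightQuaternionicInnerProductSpace V] :
    Algebra ℝ (V →L[ℍ[ℝ]ᵐᵒᵖ] V) :=
  (realScalar V).toAlgebra' fun r T => by
    ext x
    exact (T.map_smul (MulOpposite.op (r : ℍ[ℝ])) x).symm

variable (V)

/-- The two-sided ideal of compact right linear operators. -/
def compactIdeal : TwoSidedIdeal (V →L[ℍ[ℝ]ᵐᵒᵖ] V) :=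
  TwoSidedIdeal.mk' {T | IsCompactOperator T}
    isCompactOperator_zero
    (fun hS hT => hS.add hT)
    (fun hT => hT.neg)
    (fun {S _} hT => hT.clm_comp S)
    (fun {_ S} hT => hT.comp_clm S)

/-- The Calkin algebra: bounded right linear operators modulo compact ones. -/
abbrev Calkin : Type _ := (compactIdeal V).ringCon.Quotient

/-- The quotient map onto the Calkin algebra. -/
def calkinMap [RightQuaternionicInnerProductSpace V] : (V →L[ℍ[ℝ]ᵐᵒᵖ] V) →ₐ[ℝ] Calkin V :=
  { (compactIdeal V).ringCon.mk' with commutes' := fun _ => rfl }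

variable {V}

/-- The Calkin (Fredholm) S-spectrum of a bounded right linear operator. -/
def calkinSSpectrum [RightQuaternionicInnerProductSpace V] (T : V →L[ℍ[ℝ]ᵐᵒᵖ] V) : Set ℍ[ℝ] :=
  fredholmSSpectrum (calkinMap V) T

/-- The Weyl S-spectrum of a bounded right linear operator. -/
def operatorWeylSSpectrum [RightQuaternionicInnerProductSpace V] (T : V →L[ℍ[ℝ]ᵐᵒᵖ] V) :
    Set ℍ[ℝ] :=
  weylSSpectrum (calkinMap V) T

end Operators

end RightQuaternionic

end

namespace RightQuaternionic

open Topology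
open scoped Quaternion

section RealAlgebra

variable {A B R : Type*} [Ring A] [Algebra ℝ A] [Ring B] [Algebra ℝ B]
  [NormedRing R] [NormedAlgebra ℝ R]

/-! Being Weyl is a locally constant property on the Fredholm domain, and no index is needed to see
it. If `b` inverts `R_p(T)` modulo compacts, then `b R_q(T) + (1 - b R_p(T))` equals `1` at `q = p`,
hence is invertible for `q` near `p`, and it differs from `b R_q(T)` by a compact operator;
`mem_weylElements_iff_of_mul_add` then transfers the Weyl property between `p` and `q`. For a large
real `r`, `R_r(T) = (r - T)^2` is invertible, so connectedness spreads the property to the whole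
domain. The norm arguments take place in the Banach algebra of real-linear operators. -/

theorem mem_weylElements_iff {f : A →ₐ[ℝ] B} {v : A} :
    v ∈ weylElements f ↔ ∃ u : Aˣ, f v = f u := by
  constructor
  · rintro ⟨u, k, ⟨u, rfl⟩, hk, rfl⟩
    exact ⟨u, by rw [map_add, hk, add_zero]⟩
  · rintro ⟨u, hu⟩
    exact ⟨u, v - u, u.isUnit, by rw [map_sub, hu, sub_self], by abel⟩

theorem weylElements_subset_fredholmElements (f : A →ₐ[ℝ] B) :
    weylElements f ⊆ fredholmElements f := by
  intro v hv
  obtain ⟨u, hu⟩ := mem_weylElements_iff.1 hv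
  change IsUnit (f v)
  rw [hu]
  exact u.isUnit.map f

theorem map_sPoly (f : A →ₐ[ℝ] B) (q : ℍ[ℝ]) (v : A) : f (sPoly q v) = sPoly q (f v) := by
  simp [sPoly]

theorem continuous_sPoly (v : R) : Continuous fun q : ℍ[ℝ] => sPoly q v := by
  unfold sPoly
  have := Quaternion.continuous_re
  fun_prop

/-- Multiplying by an inverse modulo the kernel turns a Fredholm element into an element that is
invertible up to the kernel, which does not affect whether it is Weyl. -/
theorem mem_weylElements_iff_of_mul_add {f : A →ₐ[ℝ] B} {a a' b k : A}
    (hab : f a * f b = 1) (hk : f k = 0) (hu : IsUnit (b * a' + k)) :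
    a ∈ weylElements f ↔ a' ∈ weylElements f := by
  obtain ⟨u, hu⟩ := hu
  have hfu : f u = f b * f a' := by rw [hu, map_add, hk, add_zero, map_mul]
  simp only [mem_weylElements_iff]
  constructor
  · rintro ⟨w, hw⟩
    refine ⟨w * u, ?_⟩
    rw [Units.val_mul, map_mul, ← hw, hfu, ← mul_assoc, hab, one_mul]
  · rintro ⟨w, hw⟩
    refine ⟨w * u⁻¹, ?_⟩
    have h : f (u : A) * f (↑u⁻¹ : A) = 1 := by rw [← map_mul, Units.mul_inv, map_one]
    rw [hfu, mul_assoc] at h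
    rw [Units.val_mul, map_mul, ← hw]
    -- `f b` has left inverse `f a` and right inverse `f a' * f u⁻¹`, so the two coincide.
    exact left_inv_eq_right_inv hab h

/-- If invertibility in `A` is detected in a Banach algebra, then on a connected Fredholm S-domain
all the `R_q(v)` are Weyl elements. -/
theorem fredholmSSpectrum_eq_weylSSpectrum [CompleteSpace R] (ρ : A →ₐ[ℝ] R)
    (hρ : ∀ a, IsUnit (ρ a) → IsUnit a) (f : A →ₐ[ℝ] B) (hf : Function.Surjective f) (v : A)
    (hv : IsConnected (fredholmSDomain f v)) : fredholmSSpectrum f v = weylSSpectrum f v := by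
  have hlocal : ∀ p ∈ fredholmSDomain f v, ∀ᶠ q in 𝓝[fredholmSDomain f v] p,
      (sPoly p v ∈ weylElements f ↔ sPoly q v ∈ weylElements f) := by
    intro p hp
    obtain ⟨c, hca, hac⟩ := isUnit_iff_exists.1 (show IsUnit (f (sPoly p v)) from hp)
    obtain ⟨b, rfl⟩ := hf c
    have hcont : Continuous fun q : ℍ[ℝ] => ρ (b * sPoly q v + (1 - b * sPoly p v)) := by
      simp only [map_add, map_mul, map_sPoly]
      exact (continuous_const.mul (continuous_sPoly _)).add continuous_const
    have hunit : ∀ᶠ q in 𝓝 p, IsUnit (ρ (b * sPoly q v + (1 - b * sPoly p v))) :=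
      (Units.isOpen.preimage hcont).mem_nhds (by simp)
    filter_upwards [nhdsWithin_le_nhds hunit] with q hq
    refine mem_weylElements_iff_of_mul_add hca ?_ (hρ _ hq)
    rw [map_sub, map_one, map_mul, hac, sub_self]
  obtain ⟨r, hr⟩ : ∃ r : ℝ, IsUnit (sPoly (r : ℍ[ℝ]) v) := by
    -- The factor `‖1‖` is there because `R` is not assumed to satisfy `‖1‖ = 1`.
    refine ⟨‖ρ v‖ * ‖(1 : R)‖ + 1, ?_⟩
    set r := ‖ρ v‖ * ‖(1 : R)‖ + 1
    have h : IsUnit (algebraMap ℝ R r - ρ v) := by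
      refine spectrum.mem_resolventSet_of_norm_lt_mul (𝕜 := ℝ) ?_
      rw [Real.norm_of_nonneg (by positivity)]
      exact lt_add_one _
    have h' : IsUnit (algebraMap ℝ A r - v) := hρ _ (by simpa using h)
    have hsq : sPoly (r : ℍ[ℝ]) v = (algebraMap ℝ A r - v) ^ 2 := by
      rw [sPoly, sq v, sq (_ - v), sub_mul, mul_sub, mul_sub, Algebra.algebraMap_eq_smul_one]
      simp only [Quaternion.re_coe, Quaternion.norm_coe, Real.norm_eq_abs, sq_abs,
        smul_mul_assoc, mul_smul_comm, one_mul, mul_one]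
      module
    rw [hsq]
    exact h'.pow 2
  have hrW : sPoly (r : ℍ[ℝ]) v ∈ weylElements f := mem_weylElements_iff.2 ⟨hr.unit, rfl⟩
  ext q
  change ¬ IsUnit (sPoly q (f v)) ↔ ¬ sPoly q v ∈ weylElements f
  rw [← map_sPoly, not_iff_not]
  refine ⟨fun hq => ?_, fun hq => weylElements_subset_fredholmElements f hq⟩
  -- A symmetric, transitive relation that holds locally relates any two points of a preconnected
  -- set.
  refine (hv.isPreconnected.induction₂
    (fun p q => sPoly p v ∈ weylElements f ↔ sPoly q v ∈ weylElements f) hlocal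
    (fun _ _ _ _ _ _ => Iff.trans) (fun _ _ _ _ => Iff.symm)
    (weylElements_subset_fredholmElements f hrW) hq).1 hrW

end RealAlgebra

section Operators

variable (V : Type*) [NormedAddCommGroup V] [Module ℍ[ℝ]ᵐᵒᵖ V]
  [RightQuaternionicInnerProductSpace V]

/-- The real normed space underlying a right quaternionic inner product space. -/
noncomputable abbrev realNormedSpace : NormedSpace ℝ V where
  smul r x := MulOpposite.op (r : ℍ[ℝ]) • x
  one_smul x := by
    change MulOpposite.op ((1 : ℝ) : ℍ[ℝ]) • x = x
    simp
  mul_smul r s x := by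
    change MulOpposite.op ((r * s : ℝ) : ℍ[ℝ]) • x =
      MulOpposite.op (r : ℍ[ℝ]) • MulOpposite.op (s : ℍ[ℝ]) • x
    rw [smul_smul, ← MulOpposite.op_mul, mul_comm r s, Quaternion.coe_mul]
  smul_zero r := smul_zero (MulOpposite.op (r : ℍ[ℝ]))
  smul_add r := smul_add (MulOpposite.op (r : ℍ[ℝ]))
  add_smul r s x := by
    change MulOpposite.op ((r + s : ℝ) : ℍ[ℝ]) • x =
      MulOpposite.op (r : ℍ[ℝ]) • x + MulOpposite.op (s : ℍ[ℝ]) • x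
    rw [Quaternion.coe_add, MulOpposite.op_add, add_smul]
  zero_smul x := by
    change MulOpposite.op ((0 : ℝ) : ℍ[ℝ]) • x = 0
    simp
  norm_smul_le r x := by
    change ‖MulOpposite.op (r : ℍ[ℝ]) • x‖ ≤ ‖r‖ * ‖x‖
    rw [norm_op_smul, Quaternion.norm_coe]

attribute [local instance] realNormedSpace

/-- Bounded right linear operators, considered as bounded real linear operators. -/
noncomputable def toRealOperator : (V →L[ℍ[ℝ]ᵐᵒᵖ] V) →ₐ[ℝ] (V →L[ℝ] V) where
  toFun T :=
    { toFun := T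
      map_add' := T.map_add
      map_smul' := fun r x => T.map_smul (MulOpposite.op (r : ℍ[ℝ])) x
      cont := T.continuous }
  map_one' := rfl
  map_mul' _ _ := rfl
  map_zero' := rfl
  map_add' _ _ := rfl
  commutes' _ := rfl

variable {V}

/-- The inverse of a right linear bijection is automatically right linear, so passing to real
operators loses no information about invertibility. -/
theorem isUnit_of_isUnit_toRealOperator {T : V →L[ℍ[ℝ]ᵐᵒᵖ] V}
    (hT : IsUnit (toRealOperator V T)) : IsUnit T := by
  obtain ⟨S, hTS, hST⟩ := isUnit_iff_exists.1 hT
  have hTS' : ∀ x, T (S x) = x := fun x => DFunLike.congr_fun hTS x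
  have hST' : ∀ x, S (T x) = x := fun x => DFunLike.congr_fun hST x
  let S' : V →L[ℍ[ℝ]ᵐᵒᵖ] V :=
    { toFun := S
      map_add' := S.map_add
      map_smul' := fun q x => by
        rw [RingHom.id_apply, ← hST' (q • S x), T.map_smul, hTS']
      cont := S.continuous }
  exact isUnit_iff_exists.2 ⟨S', ContinuousLinearMap.ext hTS', ContinuousLinearMap.ext hST'⟩

theorem calkinMap_surjective : Function.Surjective (calkinMap V) :=
  (compactIdeal V).ringCon.mk'_surjective

theorem calkinSSpectrum_eq_operatorWeylSSpectrum [CompleteSpace V] (T : V →L[ℍ[ℝ]ᵐᵒᵖ] V)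
    (hT : IsConnected (fredholmSDomain (calkinMap V) T)) :
    calkinSSpectrum T = operatorWeylSSpectrum T :=
  -- Completeness of `V` makes `V →L[ℝ] V` a Banach algebra.
  fredholmSSpectrum_eq_weylSSpectrum (toRealOperator V)
    (fun _ => isUnit_of_isUnit_toRealOperator) (calkinMap V) calkinMap_surjective T hT

end Operators

end RightQuaternionic

theorem mainTheorem3 {V : Type*} [NormedAddCommGroup V] [Module (Quaternion ℝ)ᵐᵒᵖ V]
    [RightQuaternionicInnerProductSpace V] [CompleteSpace V] [TopologicalSpace.SeparableSpace V]
    (T : V →L[(Quaternion ℝ)ᵐᵒᵖ] V)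
    (hT : IsConnected (RightQuaternionic.fredholmSDomain (RightQuaternionic.calkinMap V) T)) :
    RightQuaternionic.calkinSSpectrum T = RightQuaternionic.operatorWeylSSpectrum T :=
  RightQuaternionic.calkinSSpectrum_eq_operatorWeylSSpectrum T hT
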